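/- Let $\mathbb{C}[[\mathbf q]]$ be the ring of formal power series in $q_1,q_2,q_3,\dots$, put $x=q_1$, and let $w_{kx}=\partial_x^k w$, $\rho_{kx}=\partial_x^k\rho$ denote jet variables. Define differential polynomials $K_{2n-1}$ in $w$ and $R_n$ in $(w,\rho)$, $n\ge 1$, by $K_1=w$, $$\partial_x K_{2n+1}=\bigl(2w\,\partial_x+w_x+\tfrac14\partial_x^3\bigr)K_{2n-1},\qquad K_{2n+1}|_{w_{kx}=0,\,k\ge0}=0,$$ $R_1=\rho$, $R_2=\rho^2+\rho_x+2w$, and, for $n\ge1$, $$R_{2n+1}=\bigl(\partial_x^2+2\rho\,\partial_x+\rho^2+\rho_x+2w\bigr)R_{2n-1}+\bigl(\rho+\tfrac32\partial_x\bigr)K_{2n-1},\qquad R_{2n+2}=\bigl(\partial_x^2+2\rho\,\partial_x+\rho^2+\rho_x+2w\bigr)R_{2n}.$$ A pair $(w,\rho)\in\mathbb{C}[[\mathbf q]]^2$ is a solution of the Burgers--KdV hierarchy if, for all $n\ge1$, $$\frac{\partial w}{\partial q_{2n-1}}=\partial_xK_{2n-1},\quad \frac{\partial w}{\partial q_{2n}}=0,\quad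 \frac{\partial \rho}{\partial q_{2n-1}}=\partial_xR_{2n-1},\quad \frac{\partial \rho}{\partial q_{2n}}=\partial_xR_{2n}.$$ Let $(\Omega_{i,j})_{i,j\ge1}$ be the canonical tau-structure of the KdV hierarchy, i.e. the unique family of differential polynomials in $w$ with $\Omega_{1,1}=w$, $\Omega_{i,j}=\Omega_{j,i}$, $\partial\Omega_{i,j}/\partial q_{2k-1}=\partial\Omega_{i,k}/\partial q_{2j-1}$ along the KdV flows for all $i,j,k\ge1$, and $\Omega_{i,j}|_{w_{kx}=0,\,k\ge0}=0$. **Lemma.** For every solution $(w,\rho)\in\mathbb{C}[[\mathbf q]]^2$ of the Burgers--KdV hierarchy there exists $(\tau_1,\tau_2)\in\mathbb{C}[[\mathbf q]]^2$, with nonzero constant terms (so that $\log\tau_1$, $\log\tau_2$ are defined in $\mathbb{C}[[\mathbf q]]$ up to additive constants), such that $$\frac{\partial^2\log\tau_1}{\partial q_{2i-1}\partial q_{2j-1}}=\Omega_{i,j},\qquad \frac{\partial^2\log\tau_1}{\partial q_{2i}\,\partial q_j}=0,\qquad \frac{\partial\log\tau_2}{\partial q_i}=R_i,\qquad \forall\,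 i,j\ge1,$$ where $\Omega_{i,j}$ and $R_i$ are evaluated at the solution. Moreover, $(\tau_1,\tau_2)$ is determined by $(w,\rho)$ exactly up to the freedom $$(\tau_1,\tau_2)\mapsto\bigl(\tau_1e^{\beta_0+\sum_{n\ge1}\beta_nq_n},\ \tau_2e^{\alpha_0}\bigr)$$ with arbitrary constants $\alpha_0,\beta_0,\beta_1,\beta_2,\dots\in\mathbb{C}$: if $(\tau_1,\tau_2)$ is one such pair, then the pairs obtained in this way are precisely all such pairs. -/

import Mathlib

namespace BurgersKdV

noncomputable section

open MvPolynomial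

/-! # Differential polynomials in `w` -/

/-- The ring `A_w` of differential polynomials in `w`; the variable `X k` is the jet `∂_x^k w`. -/
abbrev Aw : Type := MvPolynomial ℕ ℂ

/-- The total derivative `∂_x` on `A_w`. -/
def dx : Derivation ℂ Aw Aw := mkDerivation ℂ fun k => X (k + 1)

/-- The Lenard operator `2 w ∂_x + w_x + (1/4) ∂_x^3` of the KdV hierarchy. -/
def lenard (f : Aw) : Aw := 2 * X 0 * dx f + X 1 * f + C (1 / 4) * dx (dx (dx f))

/-- The characterization of the sequence `K n = K_{2n+1}`: the Lenard recursion, with the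
usual normalization that no constant of integration is added (`K_{2n+1}` vanishes at `w = 0`). -/
structure IsLenardSequence (K : ℕ → Aw) : Prop where
  zero : K 0 = X 0
  succ : ∀ n, dx (K (n + 1)) = lenard (K n)
  normalized : ∀ n, constantCoeff (K n) = 0

open Classical in
/-- The primitive with respect to `∂_x`, without constant term, of a total `x`-derivative. -/
def antideriv (f : Aw) : Aw :=
  if h : ∃ g, dx g = f ∧ constantCoeff g = 0 then h.choose else 0

/-- `K n` is the differential polynomial `K_{2n+1}`;
see `K_isLenardSequence` and `IsLenardSequence.eq_K`. -/
def K : ℕ → Aw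
  | 0 => X 0
  | n + 1 => antideriv (lenard (K n))

/-- `flow n` is the derivation `∂/∂q_{2n+1}` of `A_w` along the KdV flow
`∂w/∂q_{2n+1} = ∂_x K_{2n+1}`: it commutes with `∂_x`, so `∂_x^j w ↦ ∂_x^{j+1} K_{2n+1}`. -/
def flow (n : ℕ) : Derivation ℂ Aw Aw := mkDerivation ℂ fun j => (dx^[j + 1]) (K n)

/-- The canonical tau-structure of the KdV hierarchy: `Ω i j` is `Ω_{i+1,j+1}`. -/
structure IsTauStructure (Ω : ℕ → ℕ → Aw) : Prop where
  zero : Ω 0 0 = X 0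
  symm : ∀ i j, Ω i j = Ω j i
  closed : ∀ i j k, flow k (Ω i j) = flow j (Ω i k)
  normalized : ∀ i j, constantCoeff (Ω i j) = 0

/-- `Ω i j` is the component `Ω_{i+1,j+1}` of the canonical tau-structure of the KdV hierarchy;
see `Ω_isTauStructure` and `IsTauStructure.eq_Ω`, by which it is the unique family with the
defining properties. -/
def Ω (i j : ℕ) : Aw := antideriv (flow j (K i))

/-! ## The characterizations of `K` and `Ω` -/

@[simp] lemma dx_X (k : ℕ) : dx (X k) = X (k + 1) := mkDerivation_X _ _ _

@[simp] lemma dx_C (a : ℂ) : dx (C a) = 0 := derivation_C _ _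

lemma pderiv_succ_dx (k : ℕ) (f : Aw) :
    pderiv (k + 1) (dx f) = dx (pderiv (k + 1) f) + pderiv k f := by
  have h : ⁅(pderiv (k + 1) : Derivation ℂ Aw Aw), dx⁆ = pderiv k := by
    refine derivation_ext fun i => ?_
    rw [Derivation.commutator_apply, dx_X]
    simp only [pderiv_X, Pi.single_apply]
    have h3 : dx (if i = k + 1 then 1 else 0) = 0 := by split_ifs <;> simp
    rw [h3, sub_zero]
    exact if_congr (by omega) rfl rfl
  have := congrArg (fun D => D f) h
  simp only [Derivation.commutator_apply] at this
  rw [← this]; ring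

/-- The kernel of `∂_x` consists of the constants. -/
lemma eq_zero_of_dx {f : Aw} (h : dx f = 0) (h0 : constantCoeff f = 0) : f = 0 := by
  obtain ⟨N, hN⟩ : ∃ N, ∀ k, N ≤ k → pderiv k f = 0 := by
    refine ⟨f.vars.sup id + 1, fun k hk => pderiv_eq_zero_of_notMem_vars fun hm => ?_⟩
    have := Finset.le_sup (f := id) hm
    simp only [id] at this
    omega
  have hd : ∀ d k, N ≤ k + d → pderiv k f = 0 := by
    intro d
    induction d with
    | zero => intro k hk; exact hN k hk
    | succ d ih =>
      intro k hk
      have h1 := pderiv_succ_dx k f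
      rw [h, ih (k + 1) (by omega)] at h1
      simpa using h1.symm
  have hp : ∀ k, pderiv k f = 0 := fun k => hd N k (by omega)
  ext m
  by_cases hm : m = 0
  · subst hm; simpa [constantCoeff_eq] using h0
  · obtain ⟨i, hi⟩ : ∃ i, m i ≠ 0 := by
      by_contra! hc
      exact hm (Finsupp.ext hc)
    have h1 := congrArg (coeff (m - Finsupp.single i 1)) (hp i)
    rw [coeff_pderiv] at h1
    have h2 : m - Finsupp.single i 1 + Finsupp.single i 1 = m := by
      apply tsub_add_cancel_of_le
      rw [Finsupp.single_le_iff]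
      omega
    rw [h2] at h1
    simp only [coeff_zero, mul_eq_zero] at h1
    rcases h1 with h1 | h1
    · simpa using h1
    · exact absurd h1 (Nat.cast_add_one_ne_zero _)

lemma eq_of_dx {f g : Aw} (h : dx f = dx g) (hf : constantCoeff f = 0)
    (hg : constantCoeff g = 0) : f = g := by
  apply sub_eq_zero.1
  apply eq_zero_of_dx <;> simp [h, hf, hg]

lemma constantCoeff_dx (f : Aw) : constantCoeff (dx f) = 0 := by
  induction f using MvPolynomial.induction_on with
  | C a => simp
  | add p q hp hq => simp [hp, hq]
  | mul_X p n hp => simp [hp]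

/-- Total derivatives. -/
def Im : Submodule ℂ Aw := LinearMap.range dx.toLinearMap

lemma mem_Im {f : Aw} : f ∈ Im ↔ ∃ g, dx g = f := Iff.rfl

lemma dx_mem (f : Aw) : dx f ∈ Im := ⟨f, rfl⟩

lemma antideriv_spec {f : Aw} (h : f ∈ Im) :
    dx (antideriv f) = f ∧ constantCoeff (antideriv f) = 0 := by
  have h' : ∃ g, dx g = f ∧ constantCoeff g = 0 := by
    obtain ⟨g, hg⟩ := mem_Im.1 h
    exact ⟨g - C (constantCoeff g), by simp [hg], by simp⟩
  unfold antideriv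
  rw [dif_pos h']
  exact h'.choose_spec

/-- The sequence `1, K_1, K_3, K_5, …`. -/
def B : ℕ → Aw
  | 0 => 1
  | n + 1 => K n

lemma mul_dx_swap {a b : Aw} (h : a * dx b ∈ Im) : b * dx a ∈ Im := by
  have h1 : b * dx a = dx (a * b) - a * dx b := by simp
  rw [h1]; exact sub_mem (dx_mem _) h

lemma lenard_skew (a b : Aw) : a * lenard b + lenard a * b ∈ Im := by
  refine mem_Im.2 ⟨2 * X 0 * a * b
    + C (1 / 4) * (a * dx (dx b) - dx a * dx b + dx (dx a) * b), ?_⟩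
  have h2 : dx (2 : Aw) = 0 := by
    rw [← map_ofNat (C : ℂ →+* Aw) 2, dx_C]
  simp only [lenard, map_add, map_sub, Derivation.leibniz, dx_X, dx_C, h2, smul_eq_mul]
  ring

lemma B_mul_dx_mem {N : ℕ} (hB : ∀ n < N, dx (B (n + 1)) = lenard (B n)) :
    ∀ d i, i + d ≤ N → B i * dx (B (i + d)) ∈ Im := by
  have half : ∀ f : Aw, f + f ∈ Im → f ∈ Im := by
    intro f hf
    have := Im.smul_mem (1 / 2 : ℂ) hf
    rw [← two_smul ℂ f, smul_smul] at this
    simpa using this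
  have step : ∀ i j, i < N → j < N → B (i + 1) * dx (B j) ∈ Im → B i * dx (B (j + 1)) ∈ Im := by
    intro i j hi hj h
    have h1 := lenard_skew (B i) (B j)
    rw [← hB i hi, ← hB j hj] at h1
    have h2 := mul_dx_swap h
    have h3 : B i * dx (B (j + 1))
      = (B i * dx (B (j + 1)) + dx (B (i + 1)) * B j) - B j * dx (B (i + 1)) := by ring
    rw [h3]; exact sub_mem h1 h2
  intro d
  induction d using Nat.twoStepInduction with
  | zero =>
    intro i _
    apply half
    refine mem_Im.2 ⟨B i * B i, ?_⟩
    simp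
  | one =>
    intro i hi
    apply half
    have h1 := lenard_skew (B i) (B i)
    rw [← hB i (by omega)] at h1
    have h2 : B i * dx (B (i + 1)) + B i * dx (B (i + 1))
      = B i * dx (B (i + 1)) + dx (B (i + 1)) * B i := by ring
    rw [h2]; exact h1
  | more d ih _ =>
    intro i hi
    have h := ih (i + 1) (by omega)
    exact step i (i + 1 + d) (by omega) (by omega) h |> fun h => by
      rw [show i + (d + 2) = i + 1 + d + 1 by omega]; exact h

lemma dx_B_succ (n : ℕ) : dx (B (n + 1)) = lenard (B n) := by
  induction n using Nat.strong_induction_on with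
  | _ n ih =>
    cases n with
    | zero => simp [B, K, lenard]
    | succ m =>
      have hm : B 1 * dx (B (m + 1)) ∈ Im := by
        have := B_mul_dx_mem (N := m + 1) (fun k hk => ih k hk) m 1 (by omega)
        rwa [Nat.add_comm 1 m] at this
      have hl : lenard (B (m + 1)) ∈ Im := by
        have h2 : lenard (B (m + 1)) = B 1 * dx (B (m + 1)) + dx (X 0 * B (m + 1)
            + C (1 / 4) * dx (dx (B (m + 1)))) := by
          simp [lenard, B, K]; ring
        rw [h2]; exact add_mem hm (dx_mem _)
      exact (antideriv_spec hl).1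

lemma dx_K_succ (n : ℕ) : dx (K (n + 1)) = lenard (K n) := dx_B_succ (n + 1)

lemma lenard_K_mem (n : ℕ) : lenard (K n) ∈ Im := dx_K_succ n ▸ dx_mem _

lemma constantCoeff_K (n : ℕ) : constantCoeff (K n) = 0 := by
  cases n with
  | zero => simp [K]
  | succ n => exact (antideriv_spec (lenard_K_mem n)).2

/-- `K` satisfies the Lenard recursion. -/
theorem K_isLenardSequence : IsLenardSequence K := ⟨rfl, dx_K_succ, constantCoeff_K⟩

/-- `K` is the only normalized solution of the Lenard recursion. -/
theorem IsLenardSequence.eq_K {L : ℕ → Aw} (h : IsLenardSequence L) : L = K := by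
  funext n
  induction n with
  | zero => exact h.zero
  | succ n ih =>
    exact eq_of_dx (by rw [h.succ, ih, dx_K_succ]) (h.normalized _) (constantCoeff_K _)

@[simp] lemma flow_X (n k : ℕ) : flow n (X k) = (dx^[k + 1]) (K n) := mkDerivation_X _ _ _

lemma flow_dx (n : ℕ) (f : Aw) : flow n (dx f) = dx (flow n f) := by
  have h : ⁅flow n, dx⁆ = 0 := by
    refine derivation_ext fun i => ?_
    rw [Derivation.commutator_apply, dx_X, flow_X, flow_X, Function.iterate_succ_apply' dx (i + 1)]
    simp
  have := congrArg (fun D => D f) h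
  simpa [Derivation.commutator_apply, sub_eq_zero] using this

lemma flow_zero (f : Aw) : flow 0 f = dx f := by
  have h : flow 0 = dx := by
    refine derivation_ext fun i => ?_
    rw [flow_X, dx_X, K]
    have : ∀ k, (dx^[k]) (X 0) = X k := by
      intro k
      induction k with
      | zero => rfl
      | succ k ih => rw [Function.iterate_succ_apply', ih, dx_X]
    exact this _
  rw [h]

lemma constantCoeff_flow (n : ℕ) (f : Aw) : constantCoeff (flow n f) = 0 := by
  induction f using MvPolynomial.induction_on with
  | C a => simp [derivation_C]
  | add p q hp hq => simp [hp, hq]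
  | mul_X p k hp =>
    simp only [Derivation.leibniz, flow_X, smul_eq_mul, map_add, map_mul, hp,
      Function.iterate_succ_apply', constantCoeff_dx]
    simp

/-- The flow of `B j`, with the trivial flow for `B 0 = 1`. -/
def bflow : ℕ → Derivation ℂ Aw Aw
  | 0 => 0
  | n + 1 => flow n

lemma bflow_dx (n : ℕ) (f : Aw) : bflow n (dx f) = dx (bflow n f) := by
  cases n with
  | zero => simp [bflow]
  | succ n => exact flow_dx n f

lemma constantCoeff_bflow (n : ℕ) (f : Aw) : constantCoeff (bflow n f) = 0 := by
  cases n with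
  | zero => simp [bflow]
  | succ n => exact constantCoeff_flow n f

lemma bflow_w (n : ℕ) : bflow n (X 0) = dx (B n) := by
  cases n with
  | zero => simp [bflow, B]
  | succ n => simp [bflow, B]

lemma bflow_B_succ (i j : ℕ) : bflow j (B (i + 1)) - bflow (j + 1) (B i)
    = dx (B j) * B i - B j * dx (B i) := by
  induction i with
  | zero =>
    have h1 : B 1 = X 0 := rfl
    simp only [zero_add, h1, bflow_w]
    simp [B]
  | succ i ih =>
    apply eq_of_dx
    · have hc : ∀ n, bflow n (C (1 / 4)) = 0 := fun n => derivation_C _ _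
      have hc2 : ∀ n, bflow n 2 = 0 := fun n => by
        rw [← map_ofNat (C : ℂ →+* Aw) 2, derivation_C]
      have hd2 : dx (2 : Aw) = 0 := by
        rw [← map_ofNat (C : ℂ →+* Aw) 2, dx_C]
      have hw1 : ∀ n, bflow n (X 1) = dx (dx (B n)) := fun n => by
        rw [← bflow_w, ← bflow_dx, dx_X]
      have hL : ∀ n f, bflow n (lenard f) = lenard (bflow n f)
          + 2 * dx (B n) * dx f + dx (dx (B n)) * f := by
        intro n f
        simp only [lenard, map_add, Derivation.leibniz, smul_eq_mul, hc, hc2, hw1, bflow_w,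
          bflow_dx]
        ring
      have hsub : ∀ f g, lenard (f - g) = lenard f - lenard g := by
        intro f g
        simp only [lenard, map_sub]
        ring
      have e1 : dx (bflow j (B (i + 1 + 1)) - bflow (j + 1) (B (i + 1)))
          = lenard (dx (B j) * B i - B j * dx (B i))
            + 2 * dx (B j) * dx (B (i + 1)) + dx (dx (B j)) * B (i + 1)
            - 2 * dx (B (j + 1)) * dx (B i) - dx (dx (B (j + 1))) * B i := by
        rw [← ih, hsub, map_sub, ← bflow_dx, ← bflow_dx, dx_B_succ, dx_B_succ, hL, hL,
          dx_B_succ]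
        ring
      rw [e1]
      simp only [map_sub, Derivation.leibniz, smul_eq_mul, dx_B_succ i, dx_B_succ j]
      simp only [lenard, map_add, map_sub, Derivation.leibniz, smul_eq_mul, dx_X, dx_C, hd2]
      ring
    · simp [constantCoeff_bflow]
    · simp [constantCoeff_dx]

lemma bflow_B_symm (i : ℕ) : ∀ j, bflow j (B i) = bflow i (B j) := by
  induction i with
  | zero =>
    intro j
    simp [B, bflow]
  | succ i ih =>
    intro j
    have h1 := bflow_B_succ i j
    have h2 := bflow_B_succ j i
    have h3 := ih (j + 1)
    linear_combination h1 + h2 + h3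

lemma flow_K_symm (i j : ℕ) : flow j (K i) = flow i (K j) := bflow_B_symm (i + 1) (j + 1)

lemma flow_comm (i j : ℕ) (f : Aw) : flow i (flow j f) = flow j (flow i f) := by
  have hit : ∀ n k g, flow n ((dx^[k]) g) = (dx^[k]) (flow n g) := by
    intro n k
    induction k with
    | zero => intro g; rfl
    | succ k ih =>
      intro g
      rw [Function.iterate_succ_apply', Function.iterate_succ_apply', flow_dx, ih]
  have hX : ∀ k, flow i (flow j (X k)) = flow j (flow i (X k)) := by
    intro k
    rw [flow_X, flow_X, hit, hit, flow_K_symm]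
  induction f using MvPolynomial.induction_on with
  | C a => rw [derivation_C, derivation_C, map_zero, map_zero]
  | add p q hp hq => rw [map_add, map_add, map_add, map_add, hp, hq]
  | mul_X p k hp =>
    simp only [Derivation.leibniz, smul_eq_mul, map_add, hp, hX]
    ring

lemma flow_K_mem (i j : ℕ) : flow j (K i) ∈ Im := by
  have key : ∀ i j, bflow j (B i) ∈ Im := by
    intro i
    induction i with
    | zero => intro j; simp [B, Im.zero_mem]
    | succ i ih =>
      intro j
      have hmem : ∀ a b, B a * dx (B b) ∈ Im := by
        intro a b
        have h := fun a d => B_mul_dx_mem (N := a + d) (fun n _ => dx_B_succ n) d a le_rfl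
        rcases le_total a b with hab | hab
        · obtain ⟨d, rfl⟩ := Nat.exists_eq_add_of_le hab
          exact h a d
        · obtain ⟨d, rfl⟩ := Nat.exists_eq_add_of_le hab
          exact mul_dx_swap (h b d)
      have e : bflow j (B (i + 1)) = bflow (j + 1) (B i) + (B i * dx (B j) - B j * dx (B i)) := by
        linear_combination bflow_B_succ i j
      rw [e]
      exact add_mem (ih _) (sub_mem (hmem _ _) (hmem _ _))
  exact key (i + 1) (j + 1)

lemma dx_Ω (i j : ℕ) : dx (Ω i j) = flow j (K i) := (antideriv_spec (flow_K_mem i j)).1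

/-- `Ω` has the defining properties of the canonical tau-structure. -/
theorem Ω_isTauStructure : IsTauStructure Ω where
  zero := by
    apply eq_of_dx
    · rw [dx_Ω, flow_zero]; rfl
    · exact (antideriv_spec (flow_K_mem 0 0)).2
    · simp
  symm i j := by
    apply eq_of_dx
    · rw [dx_Ω, dx_Ω, flow_K_symm]
    · exact (antideriv_spec (flow_K_mem i j)).2
    · exact (antideriv_spec (flow_K_mem j i)).2
  closed i j k := by
    apply eq_of_dx
    · rw [← flow_dx, ← flow_dx, dx_Ω, dx_Ω, flow_comm]
    · exact constantCoeff_flow _ _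
    · exact constantCoeff_flow _ _
  normalized i j := (antideriv_spec (flow_K_mem i j)).2

/-- The canonical tau-structure is unique. -/
theorem IsTauStructure.eq_Ω {T : ℕ → ℕ → Aw} (h : IsTauStructure T) : T = Ω := by
  have h1 : ∀ k, T 0 k = K k := by
    intro k
    apply eq_of_dx _ (h.normalized _ _) (constantCoeff_K _)
    have := h.closed 0 0 k
    rw [h.zero, flow_zero] at this
    rw [← this]
    simp
  funext i j
  apply eq_of_dx _ (h.normalized _ _) (Ω_isTauStructure.normalized _ _)
  rw [dx_Ω, ← h1, h.symm 0 i, h.closed, flow_zero]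

/-! # Differential polynomials in `w, ρ` and the Burgers–KdV hierarchy -/

/-- The ring of differential polynomials in `w, ρ`; the variables `X (.inl k)` and `X (.inr k)`
are the jets `∂_x^k w` and `∂_x^k ρ`. -/
abbrev Awρ : Type := MvPolynomial (ℕ ⊕ ℕ) ℂ

/-- The inclusion of `A_w` into `A_{(w,ρ)}`. -/
def incl : Aw →ₐ[ℂ] Awρ := rename Sum.inl

/-- The total derivative `∂_x` on `A_{(w,ρ)}`. -/
def Dx : Derivation ℂ Awρ Awρ :=
  mkDerivation ℂ (Sum.elim (fun k => X (.inl (k + 1))) (fun k => X (.inr (k + 1))))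

/-- The operator `∂_x² + 2ρ ∂_x + ρ² + ρ_x + 2w`. -/
def burgersOp (f : Awρ) : Awρ :=
  Dx (Dx f) + 2 * X (.inr 0) * Dx f + (X (.inr 0) ^ 2 + X (.inr 1) + 2 * X (.inl 0)) * f

/-- `Rodd n` is `R_{2n+1}`. -/
def Rodd : ℕ → Awρ
  | 0 => X (.inr 0)
  | n + 1 => burgersOp (Rodd n)
      + (X (.inr 0) * incl (K n) + C (3 / 2) * Dx (incl (K n)))

/-- `Reven n` is `R_{2n+2}`. -/
def Reven : ℕ → Awρ
  | 0 => X (.inr 0) ^ 2 + X (.inr 1) + 2 * X (.inl 0)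
  | n + 1 => burgersOp (Reven n)

/-! # Power series in `q_1, q_2, …` -/

/-- The ring `ℂ[[q_1, q_2, q_3, …]]`; the variable of index `n` is `q_{n+1}`. -/
abbrev Series : Type := MvPowerSeries ℕ ℂ

/-- `dq n` is the partial derivative with respect to `q_{n+1}`; in particular `dq 0` is `∂_x`,
since `x = q_1`. -/
def dq (n : ℕ) : Derivation ℂ Series Series := MvPowerSeries.pderiv ℂ n

/-- The value of a differential polynomial at a pair of power series `(w, ρ)`. -/
def evalAt (w ρ : Series) : Awρ →ₐ[ℂ] Series :=
  aeval (Sum.elim (fun k => ((dq 0)^[k]) w) (fun k => ((dq 0)^[k]) ρ))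

/-- `(w, ρ)` is a solution of the Burgers–KdV hierarchy: for all `m ≥ 1`,
`∂w/∂q_{2m-1} = ∂_x K_{2m-1}`, `∂w/∂q_{2m} = 0`, `∂ρ/∂q_{2m-1} = ∂_x R_{2m-1}`,
`∂ρ/∂q_{2m} = ∂_x R_{2m}` (below, `n = m - 1`). -/
structure IsSolution (w ρ : Series) : Prop where
  w_odd : ∀ n, dq (2 * n) w = evalAt w ρ (Dx (incl (K n)))
  w_even : ∀ n, dq (2 * n + 1) w = 0
  ρ_odd : ∀ n, dq (2 * n) ρ = evalAt w ρ (Dx (Rodd n))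
  ρ_even : ∀ n, dq (2 * n + 1) ρ = evalAt w ρ (Dx (Reven n))

/-- The exponential of a power series `f` with arbitrary constant term `c`:
`e^f = e^c ∑_k (f - c)^k / k!`. -/
def expSeries (f : Series) : Series :=
  MvPowerSeries.C (Complex.exp (MvPowerSeries.constantCoeff f)) *
    (PowerSeries.exp ℂ).subst (f - MvPowerSeries.C (MvPowerSeries.constantCoeff f))

/-- `L` is a logarithm of `τ`. Logarithms exist exactly when `τ` has a nonzero constant term,
and any two differ by a constant in `2πiℤ`, so the derivatives of `log τ` do not depend on `L`. -/
def IsLog (L τ : Series) : Prop := expSeries L = τ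

/-- The linear series `∑_{n ≥ 1} β_n q_n`; here `b n` is `β_{n+1}`. -/
def linearSeries (b : ℕ → ℂ) : Series :=
  fun m => ∑ n ∈ m.support, if m = Finsupp.single n 1 then b n else 0

/-- `(τ₁, τ₂)` is a tau-vector of `(w, ρ)`: for all `i, j ≥ 1` (shifted by one below),
`∂² log τ₁/∂q_{2i-1}∂q_{2j-1} = Ω_{i,j}`, `∂² log τ₁/∂q_{2i}∂q_j = 0`,
`∂ log τ₂/∂q_i = R_i`. -/
def IsTauVector (w ρ τ₁ τ₂ : Series) : Prop :=
  ∃ L₁ L₂ : Series, IsLog L₁ τ₁ ∧ IsLog L₂ τ₂ ∧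
    (∀ i j, dq (2 * i) (dq (2 * j) L₁) = evalAt w ρ (incl (Ω i j))) ∧
    (∀ i j, dq (2 * i + 1) (dq j L₁) = 0) ∧
    (∀ n, dq (2 * n) L₂ = evalAt w ρ (Rodd n)) ∧
    (∀ n, dq (2 * n + 1) L₂ = evalAt w ρ (Reven n))

end

end BurgersKdV

/-!
The two tau-functions are exponentials of potentials, which exist by the Poincaré lemma for formal
power series (`exists_dq_eq`) as soon as mixed derivatives agree. For `log τ₁` this is the symmetry
and closedness of the tau-structure `Ω`, used twice. For `log τ₂` it is the symmetry of
`∂R_i/∂q_j` in `i` and `j` (`IsSolution.dq_charge`), the heart of the proof.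

It comes from the linearization of the Burgers flows. Formally, `ψ = τ₂ = exp (∫ ρ dx)` satisfies
`∂ψ/∂q_{2n} = Lⁿ ψ` and `∂ψ/∂q_{2n-1} = P_n ψ`, where `L = ∂_x² + 2w` and the `P_n` are the Lax
operators of KdV, `P_{n+1} = P_n L + K_{2n-1} ∂_x - (1/2) ∂_x K_{2n-1}`. As `ψ` is not available
yet, everything is conjugated by it: `∂/∂q_i` becomes the covariant derivative
`∇_i = ∂/∂q_i + R_i`, and in particular `∂_x` becomes `D = ∂_x + ρ`. In the algebra of endomorphisms
of `ℂ[[q]]` the operators `∇_i` commute with `D`, because `∂ρ/∂q_i = ∂_x R_i`. With the conjugates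
`M` of `L` and `P_n` of the Lax operators, `R_{2n} = Mⁿ 1` and `R_{2n-1} = P_n 1`, while
`∇_i 1 = R_i`. Hence `[∇_i, ∇_j] 1 = ∂R_j/∂q_i - ∂R_i/∂q_j`, and this vanishes because
* for `i`, `j` even, `∇_i` commutes with `M`;
* for `i` even and `j` odd, `∇_i` commutes with the Lax operator `P` of `q_j`, as `w` does not
  depend on `q_i`, while `∇_j - P` kills `1` and commutes with `M` by the Lax equation
  `[P, M] = 2 ∂w/∂q_j` (`lie_laxOp_schrodinger`);
* for `i`, `j` odd, the Lax operators `P'` of `q_i` and `P` of `q_j` satisfy the zero curvature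
  equation `[∇_i, P] - [∇_j, P'] = [P', P]`. It is a formal consequence (`lie_sub_lie_eq_lie`)
  of the Lax equations, the recursion for the Lax operators, and the two identities
  `bflow_B_symm` and `bflow_B_succ` for the KdV flows.

Uniqueness: second derivatives determine `log τ₁` up to an affine function, first derivatives
determine `log τ₂` up to a constant, and `expSeries` turns sums into products (`expSeries_add`).
-/

namespace BurgersKdV

noncomputable section

/-! ### The zero curvature equation in an associative ring -/

/-- The zero curvature equation for a hierarchy of Lax operators `P n` generated by a recursion
`P (n + 1) = P n * M + Q n`. In the application `⁅N i, ·⁆` differentiates the coefficients of an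
operator along the `i`-th flow, so that `hNM` and `hPM` together are the Lax equations, and `hNQ`,
`hQQ` concern only the operators `Q n`, which have first order. -/
theorem lie_sub_lie_eq_lie {A : Type*} [Ring A] {N P Q c : ℕ → A} {M : A}
    (hN : N 0 = 0) (hP : P 0 = 0) (hPs : ∀ n, P (n + 1) = P n * M + Q n)
    (hNM : ∀ n, ⁅N n, M⁆ = c n) (hPM : ∀ n, ⁅P n, M⁆ = c n)
    (hNQ : ∀ i j, ⁅N i, Q j⁆ = ⁅N j, Q i⁆)
    (hQQ : ∀ i j, ⁅N (j + 1), Q i⁆ - ⁅N (i + 1), Q j⁆ + ⁅Q i, Q j⁆ = 0) (i j : ℕ) :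
    ⁅N i, P j⁆ - ⁅N j, P i⁆ = ⁅P i, P j⁆ := by
  have hQM : ∀ n, ⁅Q n, M⁆ = c (n + 1) - c n * M := by
    intro n
    rw [← hPM, ← hPM, hPs]
    simp only [Ring.lie_def]; noncomm_ring
  -- `aux` measures how the curvature changes from `i` to `i + 1`; it satisfies a recursion in `j`.
  have aux : ∀ i j, ⁅N i, P j⁆ * M - ⁅N (i + 1), P j⁆ + ⁅N j, Q i⁆ + ⁅Q i, P j⁆ = 0 := by
    intro i j
    induction j with
    | zero => simp [hN, hP, Ring.lie_def]
    | succ j ih =>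
      have e : ⁅N i, P (j + 1)⁆ * M - ⁅N (i + 1), P (j + 1)⁆ + ⁅N (j + 1), Q i⁆ + ⁅Q i, P (j + 1)⁆
          = (⁅N i, P j⁆ * M - ⁅N (i + 1), P j⁆ + ⁅N j, Q i⁆ + ⁅Q i, P j⁆) * M
            + (⁅N i, Q j⁆ - ⁅N j, Q i⁆) * M
            + P j * (⁅N i, M⁆ * M - ⁅N (i + 1), M⁆ + ⁅Q i, M⁆)
            + (⁅N (j + 1), Q i⁆ - ⁅N (i + 1), Q j⁆ + ⁅Q i, Q j⁆) := by
        rw [hPs]; simp only [Ring.lie_def]; noncomm_ring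
      rw [e, ih, hQQ, hNQ i j, hNM, hNM, hQM]
      simp
  induction i with
  | zero => simp [hN, hP, Ring.lie_def]
  | succ i ih =>
    have e : ⁅N (i + 1), P j⁆ - ⁅N j, P (i + 1)⁆ - ⁅P (i + 1), P j⁆
        = (⁅N i, P j⁆ - ⁅N j, P i⁆ - ⁅P i, P j⁆) * M
          - (⁅N i, P j⁆ * M - ⁅N (i + 1), P j⁆ + ⁅N j, Q i⁆ + ⁅Q i, P j⁆)
          - P i * (⁅N j, M⁆ - ⁅P j, M⁆) := by
      rw [hPs]; simp only [Ring.lie_def]; noncomm_ring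
    rw [← sub_eq_zero, e, aux, hNM, hPM, ih]
    simp

/-! ### Differentiation of power series in infinitely many variables -/

lemma dq_comm (i j : ℕ) (f : Series) : dq i (dq j f) = dq j (dq i f) := by
  classical
  ext m
  simp only [dq, MvPowerSeries.coeff_pderiv]
  rw [add_right_comm]
  by_cases h : i = j
  · subst h; rfl
  · simp [h, Ne.symm h]
    ring

@[simp] lemma dq_C (n : ℕ) (a : ℂ) : dq n (MvPowerSeries.C a) = 0 := MvPowerSeries.pderiv_C

lemma eq_of_dq {f g : Series} (h : ∀ n, dq n f = dq n g)
    (h0 : MvPowerSeries.constantCoeff f = MvPowerSeries.constantCoeff g) : f = g :=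
  MvPowerSeries.pderiv.ext h h0

lemma eq_C_of_dq {f : Series} (h : ∀ n, dq n f = 0) :
    f = MvPowerSeries.C (MvPowerSeries.constantCoeff f) :=
  eq_of_dq (fun n => by rw [h, dq_C]) (by simp)

/-- The Poincaré lemma for closed 1-forms `∑ f n dq_{n+1}`. -/
theorem exists_dq_eq {f : ℕ → Series} (h : ∀ i j, dq i (f j) = dq j (f i)) :
    ∃ L : Series, ∀ n, dq n L = f n := by
  classical
  -- A coefficient of the potential can be read off from the derivative in any variable occurring
  -- in the monomial; closedness makes the choice immaterial.
  let L : Series := fun m => if hm : m.support.Nonempty then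
    MvPowerSeries.coeff (m - Finsupp.single hm.choose 1) (f hm.choose) / m hm.choose else 0
  refine ⟨L, fun n => ?_⟩
  ext m
  have hm : (m + Finsupp.single n 1).support.Nonempty := ⟨n, by simp⟩
  have hL : MvPowerSeries.coeff (m + Finsupp.single n 1) L
      = MvPowerSeries.coeff (m + Finsupp.single n 1 - Finsupp.single hm.choose 1) (f hm.choose)
        / ((m + Finsupp.single n 1 : ℕ →₀ ℕ) hm.choose : ℂ) := dif_pos hm
  have hk := hm.choose_spec
  generalize hm.choose = k at hL hk
  rw [dq, MvPowerSeries.coeff_pderiv, hL]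
  by_cases hkn : k = n
  · subst hkn
    have : ((m k : ℂ) + 1) ≠ 0 := Nat.cast_add_one_ne_zero _
    simp [this]
  · obtain ⟨p, rfl⟩ : ∃ p, m = p + Finsupp.single k 1 := by
      refine ⟨m - Finsupp.single k 1, (tsub_add_cancel_of_le ?_).symm⟩
      rw [Finsupp.single_le_iff]
      simp [Ne.symm hkn] at hk
      omega
    have e := congrArg (MvPowerSeries.coeff p) (h n k)
    simp only [dq, MvPowerSeries.coeff_pderiv] at e
    have h1 : ((p k : ℂ) + 1) ≠ 0 := Nat.cast_add_one_ne_zero _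
    rw [add_right_comm, add_tsub_cancel_right]
    simp only [Finsupp.add_apply, Finsupp.single_apply, hkn, Ne.symm hkn, if_false]
    push_cast
    simp only [add_zero]
    rw [div_mul_eq_mul_div, div_eq_iff h1, e]

/-! ### The exponential of a power series -/

/-- The chain rule for the substitution of a multivariate series into a univariate one. -/
theorem dq_subst {f : Series} (hf : MvPowerSeries.constantCoeff f = 0) (φ : PowerSeries ℂ)
    (n : ℕ) : dq n (φ.subst f) = (PowerSeries.derivative ℂ φ).subst f * dq n f := by
  have hs := PowerSeries.HasSubst.of_constantCoeff_zero hf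
  -- The defect of the chain rule is divisible by every power of `f`: splitting off the constant
  -- term `φ = X * ψ + a`, the defect for `φ` is `f` times the defect for `ψ`.
  have step : ∀ N (φ : PowerSeries ℂ), ∃ u : Series,
      dq n (φ.subst f) - (PowerSeries.derivative ℂ φ).subst f * dq n f = f ^ N * u := by
    intro N
    induction N with
    | zero => intro φ; exact ⟨_, by rw [pow_zero, one_mul]⟩
    | succ N ih =>
      intro φ
      obtain ⟨ψ, a, rfl⟩ : ∃ ψ a, φ = PowerSeries.X * ψ + PowerSeries.C a :=
        ⟨_, _, PowerSeries.eq_X_mul_shift_add_const φ⟩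
      obtain ⟨u, hu⟩ := ih ψ
      refine ⟨u, ?_⟩
      have hC : (PowerSeries.C a).subst f = MvPowerSeries.C a := PowerSeries.subst_C a
      rw [pow_succ', mul_assoc, ← hu]
      rw [map_add, Derivation.leibniz, PowerSeries.derivative_C, PowerSeries.derivative_X,
        add_zero, PowerSeries.subst_add hs, PowerSeries.subst_mul hs, PowerSeries.subst_X hs, hC]
      simp only [smul_eq_mul]
      rw [PowerSeries.subst_add hs, PowerSeries.subst_mul hs, PowerSeries.subst_mul hs,
        PowerSeries.subst_X hs, ← map_one (PowerSeries.C (R := ℂ)), PowerSeries.subst_C, map_one]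
      simp only [map_add, dq_C, Derivation.leibniz, smul_eq_mul]
      ring
  rw [← sub_eq_zero]
  ext m
  obtain ⟨u, hu⟩ := step (m.degree + 1) φ
  rw [hu, map_zero]
  apply MvPowerSeries.coeff_of_lt_order
  calc (m.degree : ℕ∞) < ((m.degree + 1 : ℕ) : ℕ∞) := by exact_mod_cast Nat.lt_succ_self _
    _ ≤ (f ^ (m.degree + 1)).order := by
        refine le_trans ?_ (MvPowerSeries.le_order_pow _)
        have : 1 ≤ f.order := MvPowerSeries.one_le_order_iff_constCoeff_eq_zero.2 hf
        simpa using mul_le_mul_right this ((m.degree + 1 : ℕ) : ℕ∞)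
    _ ≤ (f ^ (m.degree + 1) * u).order := le_trans le_self_add MvPowerSeries.le_order_mul

lemma constantCoeff_expSeries (f : Series) : MvPowerSeries.constantCoeff (expSeries f)
    = Complex.exp (MvPowerSeries.constantCoeff f) := by
  have hE : PowerSeries.exp ℂ
      = PowerSeries.X * (PowerSeries.mk fun p => PowerSeries.coeff (p + 1) (PowerSeries.exp ℂ))
        + 1 := by
    simpa using PowerSeries.eq_X_mul_shift_add_const (PowerSeries.exp ℂ)
  have h0 : MvPowerSeries.constantCoeff (f - MvPowerSeries.C (MvPowerSeries.constantCoeff f))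
      = 0 := by simp
  have hs := PowerSeries.HasSubst.of_constantCoeff_zero h0
  rw [expSeries, hE, PowerSeries.subst_add hs, PowerSeries.subst_mul hs, PowerSeries.subst_X hs,
    ← map_one (PowerSeries.C (R := ℂ)), PowerSeries.subst_C]
  simp

lemma dq_expSeries (n : ℕ) (f : Series) : dq n (expSeries f) = dq n f * expSeries f := by
  have h0 : MvPowerSeries.constantCoeff (f - MvPowerSeries.C (MvPowerSeries.constantCoeff f))
      = 0 := by simp
  rw [expSeries, Derivation.leibniz, dq_C, dq_subst h0, PowerSeries.derivative_exp]
  simp only [map_sub, dq_C, smul_eq_mul]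
  ring

theorem expSeries_add (f g : Series) : expSeries (f + g) = expSeries f * expSeries g := by
  -- Both sides solve the linear equations `∂u = ∂(f + g) u` with the same constant term, so that
  -- `u * exp (-(f + g))` has vanishing derivatives and constant term `1`.
  have key : ∀ u : Series, (∀ n, dq n u = dq n (f + g) * u) → MvPowerSeries.constantCoeff u
      = Complex.exp (MvPowerSeries.constantCoeff (f + g)) →
      u * expSeries (-(f + g)) = 1 := by
    intro u hu h0
    refine eq_of_dq (fun n => ?_) ?_
    · rw [Derivation.leibniz, hu, dq_expSeries, ← map_one (MvPowerSeries.C (R := ℂ)), dq_C,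
        map_neg]
      simp only [smul_eq_mul]
      ring
    · rw [map_mul, h0, constantCoeff_expSeries, ← Complex.exp_add, map_neg, add_neg_cancel,
        Complex.exp_zero, map_one]
  have h1 := key (expSeries (f + g)) (fun n => dq_expSeries n _) (constantCoeff_expSeries _)
  have h2 := key (expSeries f * expSeries g) (fun n => by
    rw [Derivation.leibniz, dq_expSeries, dq_expSeries, map_add]
    simp only [smul_eq_mul]
    ring) (by
    rw [map_mul, constantCoeff_expSeries, constantCoeff_expSeries, map_add, Complex.exp_add])
  exact (IsUnit.of_mul_eq_one_right _ h1).mul_right_cancel (h1.trans h2.symm)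

lemma dq_linearSeries (n : ℕ) (b : ℕ → ℂ) : dq n (linearSeries b) = MvPowerSeries.C (b n) := by
  classical
  ext m
  rw [dq, MvPowerSeries.coeff_pderiv, MvPowerSeries.coeff_C]
  have h : MvPowerSeries.coeff (m + Finsupp.single n 1) (linearSeries b)
      = ∑ k ∈ (m + Finsupp.single n 1).support,
        if m + Finsupp.single n 1 = Finsupp.single k 1 then b k else 0 := by
    unfold linearSeries
    exact Finset.sum_congr rfl fun k _ => by congr
  rw [h]
  by_cases hm : m = 0
  · subst hm
    rw [zero_add, Finsupp.support_single _ one_ne_zero]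
    simp
  · rw [if_neg hm, Finset.sum_eq_zero, zero_mul]
    intro k _
    rw [if_neg]
    intro hk
    have := congrArg Finsupp.degree hk
    simp only [map_add, Finsupp.degree_single] at this
    exact hm ((Finsupp.degree_eq_zero_iff m).1 (by omega))

/-! ### Operators on power series -/

/-- The covariant derivative `D + r`; it is `e^{-φ} ∘ D ∘ e^φ` whenever `D φ = r`. -/
def covDer (D : Derivation ℂ Series Series) (r : Series) : Module.End ℂ Series :=
  D.toLinearMap + LinearMap.mulLeft ℂ r

lemma covDer_apply (D : Derivation ℂ Series Series) (r f : Series) :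
    covDer D r f = D f + r * f := rfl

lemma covDer_mul (D : Derivation ℂ Series Series) (r f g : Series) :
    covDer D r (f * g) = D f * g + f * covDer D r g := by
  simp only [covDer_apply, Derivation.leibniz, smul_eq_mul]; ring

lemma covDer_one (D : Derivation ℂ Series Series) (r : Series) : covDer D r 1 = r := by
  simp [covDer_apply]

/-- The conjugated Schrödinger operator `(∂_x + ρ)² + 2w`. -/
def schrodinger (w ρ : Series) : Module.End ℂ Series :=
  covDer (dq 0) ρ * covDer (dq 0) ρ + LinearMap.mulLeft ℂ (2 * w)

lemma schrodinger_apply (w ρ f : Series) : schrodinger w ρ f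
    = covDer (dq 0) ρ (covDer (dq 0) ρ f) + 2 * w * f := rfl

/-- The first order operator `b (∂_x + ρ) - (1/2) b_x`. -/
def skewOp (ρ b : Series) : Module.End ℂ Series :=
  LinearMap.mulLeft ℂ b * covDer (dq 0) ρ
    - LinearMap.mulLeft ℂ (MvPowerSeries.C (1 / 2 : ℂ) * dq 0 b)

lemma skewOp_apply (ρ b f : Series) : skewOp ρ b f
    = b * covDer (dq 0) ρ f - MvPowerSeries.C (1 / 2 : ℂ) * dq 0 b * f := rfl

/-- The conjugated Lax operators: `P 0 = 0`, and
`P (n + 1) = P n * M + b n (∂_x + ρ) - (1/2) (b n)_x` with the Schrödinger operator `M`.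
For the sequence `b = 1, K_1, K_3, …` the operator of index `n + 1` belongs to the flow of
`q_{2n+1}`. -/
def laxOp (w ρ : Series) (b : ℕ → Series) : ℕ → Module.End ℂ Series
  | 0 => 0
  | n + 1 => laxOp w ρ b n * schrodinger w ρ + skewOp ρ (b n)

lemma lie_mul_add {A : Type*} [Ring A] (x y z u : A) :
    ⁅x, y * z + u⁆ = ⁅x, y⁆ * z + y * ⁅x, z⁆ + ⁅x, u⁆ := by
  simp only [Ring.lie_def, mul_sub, sub_mul, mul_add, add_mul, mul_assoc]; abel

lemma lie_mul_sub {A : Type*} [Ring A] (x y z u : A) :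
    ⁅x, y * z - u⁆ = ⁅x, y⁆ * z + y * ⁅x, z⁆ - ⁅x, u⁆ := by
  simp only [Ring.lie_def, mul_sub, sub_mul, mul_assoc]; abel

lemma mul_add_lie {A : Type*} [Ring A] (x y z : A) :
    ⁅x * y + z, y⁆ = ⁅x, y⁆ * y + ⁅z, y⁆ := by
  simp only [Ring.lie_def, sub_mul, mul_add, add_mul, mul_assoc]; abel

section

variable {w ρ : Series} {b : ℕ → Series}

lemma derivation_two (D : Derivation ℂ Series Series) : D 2 = 0 := by
  exact_mod_cast D.map_natCast 2

/-- The contribution of one step of the recursion for the Lax operators to the Lax equation; `a` and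
`b` are consecutive terms of a Lenard sequence. -/
lemma lie_skewOp_schrodinger {a b : Series}
    (h : dq 0 b = 2 * w * dq 0 a + dq 0 w * a
      + MvPowerSeries.C (1 / 4 : ℂ) * dq 0 (dq 0 (dq 0 a))) :
    ⁅skewOp ρ a, schrodinger w ρ⁆
      = LinearMap.mulLeft ℂ (2 * dq 0 b) - LinearMap.mulLeft ℂ (2 * dq 0 a) * schrodinger w ρ := by
  ext1 g
  simp only [Ring.lie_def, LinearMap.sub_apply, Module.End.mul_apply, skewOp_apply,
    schrodinger_apply, LinearMap.mulLeft_apply, map_add, map_sub, covDer_mul, derivation_two,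
    Derivation.leibniz, smul_eq_mul, map_zero, h, dq_C]
  have h2 : MvPowerSeries.C (σ := ℕ) (1 / 2 : ℂ) * 2 = 1 := by
    rw [← map_ofNat (MvPowerSeries.C (σ := ℕ) (R := ℂ)) 2, ← map_mul]; norm_num
  have h4 : MvPowerSeries.C (σ := ℕ) (1 / 2 : ℂ) = 2 * MvPowerSeries.C (σ := ℕ) (1 / 4 : ℂ) := by
    rw [← map_ofNat (MvPowerSeries.C (σ := ℕ) (R := ℂ)) 2, ← map_mul]; norm_num
  rw [h4] at h2 ⊢
  linear_combination (covDer (dq 0) ρ g * dq 0 (dq 0 a)) * h2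

lemma lie_skewOp_skewOp (a b : Series) : ⁅skewOp ρ a, skewOp ρ b⁆
    = skewOp ρ (a * dq 0 b - b * dq 0 a) := by
  ext1 g
  simp only [Ring.lie_def, LinearMap.sub_apply, Module.End.mul_apply, skewOp_apply,
    map_sub, covDer_mul, Derivation.leibniz, smul_eq_mul, dq_C]
  ring

/-- The flow equation `∂ρ/∂q = ∂_x r` says that `∂/∂q + r` commutes with `∂_x + ρ`. -/
lemma lie_covDer_covDer {D : Derivation ℂ Series Series} {r : Series}
    (hD : ∀ f, D (dq 0 f) = dq 0 (D f)) (hr : D ρ = dq 0 r) :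
    ⁅covDer D r, covDer (dq 0) ρ⁆ = 0 := by
  ext1 g
  simp only [Ring.lie_def, LinearMap.sub_apply, Module.End.mul_apply, covDer_apply, map_add,
    Derivation.leibniz, smul_eq_mul, hD, hr, LinearMap.zero_apply]
  ring

lemma lie_covDer_mulLeft (D : Derivation ℂ Series Series) (r f : Series) :
    ⁅covDer D r, LinearMap.mulLeft ℂ f⁆ = LinearMap.mulLeft ℂ (D f) := by
  ext1 g
  simp only [Ring.lie_def, LinearMap.sub_apply, Module.End.mul_apply, covDer_mul,
    LinearMap.mulLeft_apply]
  ring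

lemma lie_covDer_schrodinger {D : Derivation ℂ Series Series} {r : Series}
    (hD : ∀ f, D (dq 0 f) = dq 0 (D f)) (hr : D ρ = dq 0 r) :
    ⁅covDer D r, schrodinger w ρ⁆ = LinearMap.mulLeft ℂ (2 * D w) := by
  rw [schrodinger, lie_mul_add, lie_covDer_covDer hD hr, lie_covDer_mulLeft, Derivation.leibniz,
    derivation_two]
  simp

lemma lie_covDer_skewOp {D : Derivation ℂ Series Series} {r : Series}
    (hD : ∀ f, D (dq 0 f) = dq 0 (D f)) (hr : D ρ = dq 0 r) (a : Series) :
    ⁅covDer D r, skewOp ρ a⁆ = skewOp ρ (D a) := by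
  have hC : D (MvPowerSeries.C (1 / 2)) = 0 := D.map_algebraMap _
  rw [skewOp, lie_mul_sub, lie_covDer_covDer hD hr, lie_covDer_mulLeft, lie_covDer_mulLeft,
    Derivation.leibniz, hC, hD]
  simp [skewOp]

/-- The Lax equation: if `b` satisfies the Lenard recursion, the commutator of a Lax operator with
the Schrödinger operator is a multiplication operator. -/
lemma lie_laxOp_schrodinger (hb0 : dq 0 (b 0) = 0)
    (hb : ∀ n, dq 0 (b (n + 1)) = 2 * w * dq 0 (b n) + dq 0 w * b n
      + MvPowerSeries.C (1 / 4 : ℂ) * dq 0 (dq 0 (dq 0 (b n)))) (n : ℕ) :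
    ⁅laxOp w ρ b n, schrodinger w ρ⁆ = LinearMap.mulLeft ℂ (2 * dq 0 (b n)) := by
  induction n with
  | zero => simp [laxOp, hb0, Ring.lie_def]
  | succ n ih =>
    rw [laxOp, mul_add_lie, ih, lie_skewOp_schrodinger (hb n)]
    abel

lemma lie_covDer_laxOp {D : Derivation ℂ Series Series} {r : Series}
    (hD : ∀ f, D (dq 0 f) = dq 0 (D f)) (hr : D ρ = dq 0 r) (hw : D w = 0)
    (hb : ∀ n, D (b n) = 0) (n : ℕ) : ⁅covDer D r, laxOp w ρ b n⁆ = 0 := by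
  induction n with
  | zero => simp [laxOp, Ring.lie_def]
  | succ n ih =>
    rw [laxOp, lie_mul_add, ih, lie_covDer_schrodinger hD hr, lie_covDer_skewOp hD hr, hw, hb]
    simp [skewOp]

end

/-! ### Differential polynomials at a solution as values of operators -/

lemma incl_X (k : ℕ) : incl (MvPolynomial.X k) = MvPolynomial.X (.inl k) :=
  MvPolynomial.rename_X _ _

lemma incl_C (a : ℂ) : incl (MvPolynomial.C a) = MvPolynomial.C a := MvPolynomial.rename_C _ _

lemma incl_dx (f : Aw) : incl (dx f) = Dx (incl f) := by
  induction f using MvPolynomial.induction_on with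
  | C a => simp [MvPolynomial.derivation_C]
  | add p q hp hq => simp only [map_add, hp, hq]
  | mul_X p n hp =>
    have : Dx (MvPolynomial.X (.inl n)) = MvPolynomial.X (.inl (n + 1)) :=
      MvPolynomial.mkDerivation_X _ _ _
    simp only [Derivation.leibniz, smul_eq_mul, map_add, map_mul, hp, dx_X, incl_X, this]

section

variable (w ρ : Series)

@[simp] lemma evalAt_inl (k : ℕ) : evalAt w ρ (MvPolynomial.X (.inl k)) = ((dq 0)^[k]) w :=
  MvPolynomial.aeval_X _ _

@[simp] lemma evalAt_inr (k : ℕ) : evalAt w ρ (MvPolynomial.X (.inr k)) = ((dq 0)^[k]) ρ :=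
  MvPolynomial.aeval_X _ _

lemma evalAt_C (a : ℂ) : evalAt w ρ (MvPolynomial.C a) = MvPowerSeries.C a :=
  MvPolynomial.aeval_C _ _

lemma dq_evalAt (f : Awρ) : dq 0 (evalAt w ρ f) = evalAt w ρ (Dx f) := by
  induction f using MvPolynomial.induction_on with
  | C a => rw [evalAt_C, dq_C, MvPolynomial.derivation_C, map_zero]
  | add p q hp hq => simp only [map_add, hp, hq]
  | mul_X p n hp =>
    have : dq 0 (evalAt w ρ (MvPolynomial.X n)) = evalAt w ρ (Dx (MvPolynomial.X n)) := by
      rw [Dx, MvPolynomial.mkDerivation_X]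
      cases n <;> simp [Function.iterate_succ_apply', -Function.iterate_succ]
    simp only [Derivation.leibniz, smul_eq_mul, map_add, map_mul, hp, this]

variable {w ρ}

/-- A flow on differential polynomials in `w` computes the derivative of their values along `D`,
provided that it does so for `w` itself. -/
lemma derivation_evalAt_incl {D : Derivation ℂ Series Series} {E : Derivation ℂ Aw Aw}
    (hD : ∀ f, D (dq 0 f) = dq 0 (D f)) (hE : ∀ f, E (dx f) = dx (E f))
    (hw : D w = evalAt w ρ (incl (E (MvPolynomial.X 0)))) (f : Aw) :
    D (evalAt w ρ (incl f)) = evalAt w ρ (incl (E f)) := by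
  have hX : ∀ k, D (evalAt w ρ (incl (MvPolynomial.X k)))
      = evalAt w ρ (incl (E (MvPolynomial.X k))) := by
    intro k
    induction k with
    | zero => rw [incl_X, evalAt_inl]; exact hw
    | succ k ih => rw [← dx_X, hE, incl_dx, incl_dx, ← dq_evalAt, ← dq_evalAt, hD, ih]
  induction f using MvPolynomial.induction_on with
  | C a =>
    rw [MvPolynomial.derivation_C, incl_C, evalAt_C, map_zero, map_zero]
    exact D.map_algebraMap a
  | add p q hp hq => simp only [map_add, hp, hq]
  | mul_X p n hp => simp only [Derivation.leibniz, smul_eq_mul, map_add, map_mul, hp, hX]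

lemma evalAt_burgersOp (f : Awρ) :
    evalAt w ρ (burgersOp f) = schrodinger w ρ (evalAt w ρ f) := by
  simp only [burgersOp, schrodinger_apply, covDer_apply, map_add, map_mul, map_pow, map_ofNat,
    evalAt_inl, evalAt_inr, ← dq_evalAt, Derivation.leibniz, smul_eq_mul,
    Function.iterate_zero, Function.iterate_one, id]
  ring

lemma evalAt_Reven (n : ℕ) : evalAt w ρ (Reven n) = (schrodinger w ρ ^ (n + 1)) 1 := by
  induction n with
  | zero =>
    have h : Reven 0 = burgersOp 1 := by simp [Reven, burgersOp]
    rw [h, evalAt_burgersOp, zero_add, pow_one, map_one]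
  | succ n ih => rw [Reven, evalAt_burgersOp, ih, pow_succ' _ (n + 1), Module.End.mul_apply]

/-- The sequence `1, K_1, K_3, …`, evaluated at `w`. (The value does not depend on `ρ`.) -/
def lenardSeries (w ρ : Series) (n : ℕ) : Series := evalAt w ρ (incl (B n))

lemma dq_lenardSeries_succ (n : ℕ) : dq 0 (lenardSeries w ρ (n + 1))
    = 2 * w * dq 0 (lenardSeries w ρ n) + dq 0 w * lenardSeries w ρ n
      + MvPowerSeries.C (1 / 4 : ℂ) * dq 0 (dq 0 (dq 0 (lenardSeries w ρ n))) := by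
  simp only [lenardSeries, dq_evalAt, ← incl_dx, dx_B_succ, lenard, map_add, map_mul, incl_X,
    incl_C, evalAt_C, evalAt_inl, map_ofNat, Function.iterate_zero, Function.iterate_one, id]

lemma lie_laxOp_lenardSeries (n : ℕ) : ⁅laxOp w ρ (lenardSeries w ρ) n, schrodinger w ρ⁆
    = LinearMap.mulLeft ℂ (2 * dq 0 (lenardSeries w ρ n)) :=
  lie_laxOp_schrodinger (by simp [lenardSeries, B]) dq_lenardSeries_succ n

/-- The recursion for `R_{2n+1}` multiplies by `M` from the left, that for the Lax operators from the
right; the Lax equation converts the term `(3/2) ∂_x K` of the former into the term `-(1/2) ∂_x K`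
of the latter. -/
lemma evalAt_Rodd (n : ℕ) :
    evalAt w ρ (Rodd n) = laxOp w ρ (lenardSeries w ρ) (n + 1) 1 := by
  induction n with
  | zero =>
    simp [laxOp, Rodd, lenardSeries, B, skewOp_apply, covDer_one]
  | succ n ih =>
    have h := congrArg (fun T : Module.End ℂ Series => T 1)
      (lie_laxOp_lenardSeries (w := w) (ρ := ρ) (n + 1))
    simp only [Ring.lie_def, LinearMap.sub_apply, Module.End.mul_apply,
      LinearMap.mulLeft_apply] at h
    have h3 : MvPowerSeries.C (σ := ℕ) (3 / 2 : ℂ) = 2 - MvPowerSeries.C (σ := ℕ) (1 / 2 : ℂ) := by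
      rw [← map_ofNat (MvPowerSeries.C (σ := ℕ) (R := ℂ)) 2, ← map_sub]; norm_num
    have hP : laxOp w ρ (lenardSeries w ρ) (n + 1 + 1) = laxOp w ρ (lenardSeries w ρ) (n + 1)
      * schrodinger w ρ + skewOp ρ (lenardSeries w ρ (n + 1)) := rfl
    have hK : evalAt w ρ (incl (K n)) = lenardSeries w ρ (n + 1) := rfl
    rw [Rodd, map_add, evalAt_burgersOp, ih, hP, LinearMap.add_apply, Module.End.mul_apply,
      skewOp_apply, covDer_one]
    simp only [map_add, map_mul, evalAt_C, ← dq_evalAt, hK, evalAt_inr, Function.iterate_zero,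
      id, h3]
    linear_combination -h
end

/-! ### Symmetry of the derivatives of the densities `R_i` -/

lemma skewOp_add (ρ a b : Series) : skewOp ρ (a + b) = skewOp ρ a + skewOp ρ b := by
  ext1 g
  simp only [skewOp_apply, LinearMap.add_apply, map_add]
  ring

/-- The derivations `0, ∂/∂q_1, ∂/∂q_3, …`, indexed like the sequence `B` and the flows `bflow`. -/
def oddFlow : ℕ → Derivation ℂ Series Series
  | 0 => 0
  | n + 1 => dq (2 * n)

/-- The sequence `0, R_1, R_3, …` at `(w, ρ)`, indexed like the derivations `oddFlow`. -/
def oddCharge (w ρ : Series) : ℕ → Series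
  | 0 => 0
  | n + 1 => evalAt w ρ (Rodd n)

lemma oddCharge_eq (w ρ : Series) (n : ℕ) :
    oddCharge w ρ n = laxOp w ρ (lenardSeries w ρ) n 1 := by
  cases n with
  | zero => simp [oddCharge, laxOp]
  | succ n => exact evalAt_Rodd n

lemma oddFlow_dq (n : ℕ) (f : Series) : oddFlow n (dq 0 f) = dq 0 (oddFlow n f) := by
  cases n with
  | zero => simp [oddFlow]
  | succ n => exact dq_comm _ _ _

namespace IsSolution
variable {w ρ : Series} (h : IsSolution w ρ)
include h

lemma oddFlow_ρ (n : ℕ) : oddFlow n ρ = dq 0 (oddCharge w ρ n) := by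
  cases n with
  | zero => simp [oddFlow, oddCharge]
  | succ n => rw [oddFlow, h.ρ_odd, oddCharge, dq_evalAt]

lemma even_ρ (n : ℕ) : dq (2 * n + 1) ρ = dq 0 (evalAt w ρ (Reven n)) := by
  rw [h.ρ_even, dq_evalAt]

lemma oddFlow_evalAt (n : ℕ) (f : Aw) :
    oddFlow n (evalAt w ρ (incl f)) = evalAt w ρ (incl (bflow n f)) := by
  refine derivation_evalAt_incl (oddFlow_dq n) (bflow_dx n) ?_ f
  cases n with
  | zero => simp [oddFlow, bflow]
  | succ n => rw [oddFlow, h.w_odd, bflow_w, incl_dx, B]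

lemma even_evalAt (n : ℕ) (f : Aw) : dq (2 * n + 1) (evalAt w ρ (incl f)) = 0 := by
  have := derivation_evalAt_incl (w := w) (ρ := ρ) (D := dq (2 * n + 1)) (E := 0)
    (fun f => dq_comm _ _ f) (by simp) (by simp [h.w_even]) f
  simpa using this

lemma oddFlow_w (n : ℕ) : oddFlow n w = dq 0 (lenardSeries w ρ n) := by
  have := h.oddFlow_evalAt n (MvPolynomial.X 0)
  rw [incl_X, evalAt_inl, bflow_w, incl_dx, ← dq_evalAt] at this
  exact this

lemma zero_curvature (i j : ℕ) :
    ⁅covDer (oddFlow i) (oddCharge w ρ i), laxOp w ρ (lenardSeries w ρ) j⁆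
      - ⁅covDer (oddFlow j) (oddCharge w ρ j), laxOp w ρ (lenardSeries w ρ) i⁆
      = ⁅laxOp w ρ (lenardSeries w ρ) i, laxOp w ρ (lenardSeries w ρ) j⁆ := by
  refine lie_sub_lie_eq_lie (M := schrodinger w ρ)
    (N := fun n => covDer (oddFlow n) (oddCharge w ρ n))
    (Q := fun n => skewOp ρ (lenardSeries w ρ n))
    (c := fun n => LinearMap.mulLeft ℂ (2 * dq 0 (lenardSeries w ρ n)))
    ?_ rfl (fun n => rfl) (fun n => ?_) lie_laxOp_lenardSeries (fun i j => ?_) (fun i j => ?_) i j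
  · ext1 g
    simp [covDer_apply, oddFlow, oddCharge]
  · rw [lie_covDer_schrodinger (oddFlow_dq n) (h.oddFlow_ρ n), h.oddFlow_w]
  · rw [lie_covDer_skewOp (oddFlow_dq i) (h.oddFlow_ρ i),
      lie_covDer_skewOp (oddFlow_dq j) (h.oddFlow_ρ j), lenardSeries, lenardSeries,
      h.oddFlow_evalAt, h.oddFlow_evalAt, bflow_B_symm]
  · rw [lie_covDer_skewOp (oddFlow_dq _) (h.oddFlow_ρ _),
      lie_covDer_skewOp (oddFlow_dq _) (h.oddFlow_ρ _), lie_skewOp_skewOp,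
      sub_add_eq_add_sub, sub_eq_zero, ← skewOp_add]
    congr 1
    simp only [lenardSeries, h.oddFlow_evalAt, dq_evalAt, ← incl_dx, ← map_mul, ← map_sub,
      ← map_add]
    congr 2
    linear_combination bflow_B_symm (i + 1) j - bflow_B_succ i j

/-- `∂R_{2j+1}/∂q_{2i+1} = ∂R_{2i+1}/∂q_{2j+1}`: apply the zero curvature equation to `1`. -/
lemma odd_odd (i j : ℕ) :
    dq (2 * i) (evalAt w ρ (Rodd j)) = dq (2 * j) (evalAt w ρ (Rodd i)) := by
  have h1 := congrArg (fun T : Module.End ℂ Series => T 1) (h.zero_curvature (i + 1) (j + 1))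
  simp only [Ring.lie_def, LinearMap.sub_apply, Module.End.mul_apply, covDer_one,
    ← oddCharge_eq] at h1
  simp only [covDer_apply, oddFlow] at h1
  simp only [oddCharge] at h1
  linear_combination h1

/-- `∂R_{2j+2}/∂q_{2i+2} = ∂R_{2i+2}/∂q_{2j+2}`. -/
lemma even_even (i j : ℕ) :
    dq (2 * i + 1) (evalAt w ρ (Reven j)) = dq (2 * j + 1) (evalAt w ρ (Reven i)) := by
  -- `∇_{2i+2} R_{2j+2} = M ^ (i + j + 2) 1`, which is symmetric.
  have key : ∀ i j, dq (2 * i + 1) (evalAt w ρ (Reven j)) = (schrodinger w ρ ^ (j + 1 + (i + 1))) 1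
      - evalAt w ρ (Reven i) * evalAt w ρ (Reven j) := by
    intro i j
    have h1 : Commute (covDer (dq (2 * i + 1)) (evalAt w ρ (Reven i))) (schrodinger w ρ) := by
      rw [commute_iff_lie_eq, lie_covDer_schrodinger (fun f => dq_comm _ _ f) (h.even_ρ i),
        h.w_even]
      simp
    have h2 := congrArg (fun T : Module.End ℂ Series => T 1) (h1.pow_right (j + 1)).eq
    simp only [Module.End.mul_apply, covDer_one, ← evalAt_Reven j] at h2
    rw [evalAt_Reven i, ← Module.End.mul_apply, ← pow_add] at h2
    rw [← h2, covDer_apply, evalAt_Reven i]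
    ring
  rw [key, key, add_comm (j + 1), mul_comm]

/-- `∂R_{2j+1}/∂q_{2i+2} = ∂R_{2i+2}/∂q_{2j+1}`: both are
`P R_{2i+2} - R_{2i+2} R_{2j+1}` with the Lax operator `P` of `q_{2j+1}`. -/
lemma even_odd (i j : ℕ) :
    dq (2 * i + 1) (evalAt w ρ (Rodd j)) = dq (2 * j) (evalAt w ρ (Reven i)) := by
  have h1 : Commute (covDer (oddFlow (j + 1)) (oddCharge w ρ (j + 1))
      - laxOp w ρ (lenardSeries w ρ) (j + 1)) (schrodinger w ρ) := by
    have e : ∀ x y z : Module.End ℂ Series, ⁅x - y, z⁆ = ⁅x, z⁆ - ⁅y, z⁆ := by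
      intro x y z; simp only [Ring.lie_def, sub_mul, mul_sub]; abel
    rw [commute_iff_lie_eq, e, lie_covDer_schrodinger (oddFlow_dq _) (h.oddFlow_ρ _),
      lie_laxOp_lenardSeries, h.oddFlow_w, sub_self]
  -- `∇ - P` kills `1` and commutes with `M`, hence it kills `M ^ (i + 1) 1`.
  have h2 := congrArg (fun T : Module.End ℂ Series => T 1) (h1.pow_right (i + 1)).eq
  simp only [Module.End.mul_apply, LinearMap.sub_apply, covDer_one, oddCharge_eq, sub_self,
    map_zero, ← evalAt_Reven i] at h2
  have h3 := congrArg (fun T : Module.End ℂ Series => T 1)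
    (lie_covDer_laxOp (fun f => dq_comm (2 * i + 1) _ f) (h.even_ρ i) (h.w_even i)
      (b := lenardSeries w ρ) (fun n => h.even_evalAt i _) (j + 1))
  simp only [Ring.lie_def, Module.End.mul_apply, LinearMap.sub_apply, covDer_one,
    LinearMap.zero_apply] at h3
  simp only [covDer_apply, ← evalAt_Rodd, oddFlow] at h2 h3
  linear_combination h3 - h2

end IsSolution

/-! ### Existence and uniqueness of the tau-vector -/

/-- The prescribed derivatives of `log τ₂`: `charge w ρ n` is `R_{n+1}` at `(w, ρ)`. -/
def charge (w ρ : Series) (n : ℕ) : Series :=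
  evalAt w ρ (if Even n then Rodd (n / 2) else Reven (n / 2))

/-- The prescribed second derivatives of `log τ₁` with respect to `q_{i+1}` and `q_{j+1}`. -/
def tauHessian (w ρ : Series) (i j : ℕ) : Series :=
  if Even i ∧ Even j then evalAt w ρ (incl (Ω (i / 2) (j / 2))) else 0

section

variable (w ρ : Series)
lemma charge_even (n : ℕ) : charge w ρ (2 * n) = evalAt w ρ (Rodd n) := by
  simp [charge]

lemma charge_odd (n : ℕ) : charge w ρ (2 * n + 1) = evalAt w ρ (Reven n) := by
  rw [charge, if_neg (by simp), show (2 * n + 1) / 2 = n by omega]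

lemma tauHessian_even (i j : ℕ) :
    tauHessian w ρ (2 * i) (2 * j) = evalAt w ρ (incl (Ω i j)) := by
  simp [tauHessian]

lemma tauHessian_odd (i j : ℕ) : tauHessian w ρ (2 * i + 1) j = 0 := by
  simp [tauHessian]

lemma tauHessian_symm (i j : ℕ) : tauHessian w ρ i j = tauHessian w ρ j i := by
  simp only [tauHessian, and_comm, Ω_isTauStructure.symm (i / 2)]
end

lemma forall_even_odd {p : ℕ → Prop} : (∀ n, p n) ↔ (∀ n, p (2 * n)) ∧ ∀ n, p (2 * n + 1) := by
  refine ⟨fun h => ⟨fun n => h _, fun n => h _⟩, fun h n => ?_⟩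
  obtain ⟨k, rfl | rfl⟩ := Nat.even_or_odd' n
  exacts [h.1 k, h.2 k]

lemma isTauVector_iff {w ρ τ₁ τ₂ : Series} : IsTauVector w ρ τ₁ τ₂ ↔
    ∃ L₁ L₂ : Series, IsLog L₁ τ₁ ∧ IsLog L₂ τ₂ ∧
      (∀ i j, dq i (dq j L₁) = tauHessian w ρ i j) ∧ ∀ n, dq n L₂ = charge w ρ n := by
  refine exists_congr fun L₁ => exists_congr fun L₂ => and_congr_right fun _ =>
    and_congr_right fun _ => ?_
  rw [← and_assoc]
  refine and_congr ⟨fun ⟨h1, h2⟩ i j => ?_, fun h => ⟨fun i j => ?_, fun i j => ?_⟩⟩ ?_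
  · obtain ⟨a, rfl | rfl⟩ := Nat.even_or_odd' i
    · obtain ⟨b, rfl | rfl⟩ := Nat.even_or_odd' j
      · rw [h1, tauHessian_even]
      · rw [dq_comm, h2, tauHessian_symm, tauHessian_odd]
    · rw [h2, tauHessian_odd]
  · rw [h, tauHessian_even]
  · rw [h, tauHessian_odd]
  · simp only [forall_even_odd (p := fun n => dq n L₂ = charge w ρ n), charge_even, charge_odd]

lemma IsSolution.dq_charge {w ρ : Series} (h : IsSolution w ρ) (i j : ℕ) :
    dq i (charge w ρ j) = dq j (charge w ρ i) := by
  obtain ⟨a, rfl | rfl⟩ := Nat.even_or_odd' i <;> obtain ⟨b, rfl | rfl⟩ := Nat.even_or_odd' j <;>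
    simp only [charge_even, charge_odd]
  · exact h.odd_odd a b
  · exact (h.even_odd b a).symm
  · exact h.even_odd a b
  · exact h.even_even a b

lemma IsSolution.dq_tauHessian {w ρ : Series} (h : IsSolution w ρ) (i j k : ℕ) :
    dq k (tauHessian w ρ i j) = dq j (tauHessian w ρ i k) := by
  have hodd : ∀ c i j, dq (2 * c + 1) (tauHessian w ρ i j) = 0 := by
    intro c i j
    unfold tauHessian
    split_ifs
    · exact h.even_evalAt _ _
    · exact map_zero _
  obtain ⟨a, rfl | rfl⟩ := Nat.even_or_odd' i
  · obtain ⟨b, rfl | rfl⟩ := Nat.even_or_odd' j <;> obtain ⟨c, rfl | rfl⟩ := Nat.even_or_odd' k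
    · rw [tauHessian_even, tauHessian_even]
      have e := fun n f => h.oddFlow_evalAt (n + 1) f
      simp only [oddFlow, bflow] at e
      rw [e, e, Ω_isTauStructure.closed]
    · rw [hodd, tauHessian_symm, tauHessian_odd, map_zero]
    · rw [hodd, tauHessian_symm, tauHessian_odd, map_zero]
    · rw [hodd, hodd]
  · rw [tauHessian_odd, tauHessian_odd, map_zero, map_zero]

theorem IsSolution.exists_isTauVector {w ρ : Series} (h : IsSolution w ρ) :
    ∃ τ₁ τ₂ : Series, IsTauVector w ρ τ₁ τ₂ := by
  choose g hg using fun i => exists_dq_eq (f := tauHessian w ρ i) (fun k j => h.dq_tauHessian i j k)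
  obtain ⟨L₁, hL₁⟩ := exists_dq_eq (f := g) fun i j => by rw [hg, hg, tauHessian_symm]
  obtain ⟨L₂, hL₂⟩ := exists_dq_eq h.dq_charge
  exact ⟨expSeries L₁, expSeries L₂, isTauVector_iff.2 ⟨L₁, L₂, rfl, rfl,
    fun i j => by rw [hL₁, hg, tauHessian_symm], hL₂⟩⟩

lemma exists_eq_add_linearSeries {f g : Series} (h : ∀ i j, dq i (dq j f) = dq i (dq j g)) :
    ∃ (c : ℂ) (b : ℕ → ℂ), g = f + (MvPowerSeries.C c + linearSeries b) := by
  have h1 : ∀ j, ∃ b : ℂ, dq j (g - f) = MvPowerSeries.C b := fun j =>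
    ⟨_, eq_C_of_dq fun i => by rw [map_sub, map_sub, h, sub_self]⟩
  choose b hb using h1
  refine ⟨MvPowerSeries.constantCoeff (g - f - linearSeries b), b, ?_⟩
  rw [← eq_C_of_dq (f := g - f - linearSeries b) fun n => by
    rw [map_sub, hb, dq_linearSeries, sub_self]]
  abel

end

end BurgersKdV

theorem lemma1 (w ρ : BurgersKdV.Series) (h : BurgersKdV.IsSolution w ρ) :
    (∃ τ₁ τ₂ : BurgersKdV.Series, BurgersKdV.IsTauVector w ρ τ₁ τ₂) ∧
    ∀ τ₁ τ₂ : BurgersKdV.Series, BurgersKdV.IsTauVector w ρ τ₁ τ₂ →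
      ∀ τ₁' τ₂' : BurgersKdV.Series, BurgersKdV.IsTauVector w ρ τ₁' τ₂' ↔
        ∃ (β₀ : ℂ) (β : ℕ → ℂ) (α₀ : ℂ),
          τ₁' = τ₁ * BurgersKdV.expSeries
            (MvPowerSeries.C β₀ + BurgersKdV.linearSeries β) ∧
          τ₂' = τ₂ * BurgersKdV.expSeries (MvPowerSeries.C α₀) := by
  open BurgersKdV in
  refine ⟨h.exists_isTauVector, fun τ₁ τ₂ hτ τ₁' τ₂' => ?_⟩
  obtain ⟨L₁, L₂, rfl, rfl, h₁, h₂⟩ := isTauVector_iff.1 hτ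
  rw [isTauVector_iff]
  constructor
  · rintro ⟨L₁', L₂', rfl, rfl, h₁', h₂'⟩
    obtain ⟨c, b, hL⟩ := exists_eq_add_linearSeries (f := L₁) (g := L₁')
      fun i j => by rw [h₁, h₁']
    have hL₂ := eq_C_of_dq (f := L₂' - L₂) fun n => by rw [map_sub, h₂, h₂', sub_self]
    refine ⟨c, b, MvPowerSeries.constantCoeff (L₂' - L₂), ?_, ?_⟩
    · rw [← expSeries_add, hL]
    · rw [← hL₂, ← expSeries_add, add_sub_cancel]
  · rintro ⟨β₀, β, α₀, rfl, rfl⟩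
    refine ⟨L₁ + (MvPowerSeries.C β₀ + linearSeries β), L₂ + MvPowerSeries.C α₀,
      expSeries_add _ _, expSeries_add _ _, fun i j => ?_, fun n => ?_⟩
    · simp only [map_add, dq_C, dq_linearSeries, h₁, map_zero, add_zero]
    · rw [map_add, dq_C, h₂, add_zero]
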